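/- Let $K$ be a field and let $G$ be a finite group. For a finite separable extension $L/L_0$ of fields containing $K$, say that $L/L_0$ is defined over a field $E_0$ with $K\subseteq E_0\subseteq L_0$ if there is a field $E$ with $E_0\subseteq E\subseteq L$, $[E:E_0]=[L:L_0]$ and $L=EL_0$; the essential dimension $\operatorname{ed}_K(L/L_0)$ is the minimum of $\operatorname{trdeg}_K E_0$ over all $E_0$ over which $L/L_0$ is defined. The essential dimension of $G$ over $K$ is $\operatorname{ed}_K(G)=\operatorname{ed}_K(K(V)/K(V)^G)$, where $V$ is a faithful finite-dimensional representation of $G$ over $K$ (for instance the regular representation), $K(V)=K(x_1,\dots,x_n)$, with $x_1,\dots,x_n$ a basis of the dual space $V^*$, is the function field of the affine space $V$, and $K(V)^G$ is the subfield of $G$-invariants. Theorem. Let $p$ be a prime number, $r\ge 0$ an integer, and $K$ any field with $\operatorname{char}K\neq p$ that contains a primitive $p$-th root of unity. Then $\operatorname{ed}_K((\mathbb Z/p\mathbb Z)^r)=r$; that is, $\operatorname{ed}_K(K(V)/K(V)^G)=r$ for $G=(\mathbb Z/p\mathbb Z)^r$ and every faithful finite-dimensional representation $V$ of $G$ over $K$,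 in particular for the regular representation. In particular, $\operatorname{ed}_K((\mathbb Z/2\mathbb Z)^r)=r$, in the same sense, for every field $K$ with $\operatorname{char}K\neq 2$. -/

import Mathlib

universe u v w

noncomputable section

namespace EssDim

section Extension

variable {K : Type u} {L : Type v} [Field K] [Field L] [Algebra K L]

/-- For a (finite separable) extension `L / L₀` of fields containing `K`, and a field `E₀` between
`K` and `L₀`: `L / L₀` is defined over `E₀` if there is a field `E` with `E₀ ⊆ E ⊆ L`,
`[E : E₀] = [L : L₀]` and `L = E L₀`. -/
def IsDefinedOver (L₀ E₀ : IntermediateField K L) : Prop :=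
  E₀ ≤ L₀ ∧ ∃ E : IntermediateField K L,
    E₀ ≤ E ∧ E₀.relrank E = Module.rank L₀ L ∧ E ⊔ L₀ = ⊤

/-- The essential dimension `ed_K(L / L₀)`: the minimum of `trdeg_K E₀` over all `E₀` over which
`L / L₀` is defined. The set is nonempty, as it contains `trdeg_K L₀` (take `E = L`), and cardinals
are well ordered, so the infimum is a minimum. -/
def extEssDim (L₀ : IntermediateField K L) : Cardinal.{v} :=
  sInf {d | ∃ E₀ : IntermediateField K L, IsDefinedOver L₀ E₀ ∧ Algebra.trdeg K E₀ = d}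

end Extension

section Representation

variable {K : Type u} {G : Type v} {V : Type w} [Field K] [Group G] [AddCommGroup V] [Module K V]

variable (K V) in
/-- The ring `K[V] = Sym(V*)` of polynomial functions on `V`. -/
abbrev CoordRing : Type (max u w) := SymmetricAlgebra K (Module.Dual K V)

variable (K V) in
/-- The function field `K(V)` of the affine space `V`, i.e. the rational function field
`K(x₁, …, xₙ)` for a basis `x₁, …, xₙ` of the dual space of `V`. -/
abbrev FunField : Type (max u w) := FractionRing (CoordRing K V)

/-- The action of `G` on `K[V]` by `K`-algebra endomorphisms that extends the contragredient
action on the linear forms `V*`. -/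
def coordRingEnd (ρ : Representation K G V) : G →* (CoordRing K V →ₐ[K] CoordRing K V) where
  toFun g := SymmetricAlgebra.lift (SymmetricAlgebra.ι K (Module.Dual K V) ∘ₗ ρ.dual g)
  map_one' := by
    rw [map_one, Module.End.one_eq_id, LinearMap.comp_id, SymmetricAlgebra.lift_ι]
    rfl
  map_mul' g h := by
    apply SymmetricAlgebra.algHom_ext
    ext x
    simp [Module.Dual.transpose_apply, LinearMap.comp_assoc, Module.End.mul_eq_comp]

/-- The action of `G` on `K[V]` by `K`-algebra automorphisms. -/
def coordRingAut (ρ : Representation K G V) : G →* (CoordRing K V ≃ₐ[K] CoordRing K V) :=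
  (AlgEquiv.algHomUnitsEquiv K (CoordRing K V)).toMonoidHom.comp (coordRingEnd ρ).toHomUnits

/-- The action of `G` on `K(V)` by `K`-automorphisms. -/
def funFieldAut (ρ : Representation K G V) : G →* (FunField K V ≃ₐ[K] FunField K V) :=
  (IsFractionRing.fieldEquivOfAlgEquivHom K (FunField K V)).comp (coordRingAut ρ)

/-- The field of invariants `K(V)^G`. -/
def funFieldInvariants (ρ : Representation K G V) : IntermediateField K (FunField K V) :=
  IntermediateField.fixedField (funFieldAut ρ).range

/-- `ed_K(K(V) / K(V)^G)`. -/
def repEssDim (ρ : Representation K G V) : Cardinal.{max u w} :=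
  extEssDim (funFieldInvariants ρ)

end Representation

/-- The essential dimension `ed_K(G) = ed_K(K(V) / K(V)^G)` of a finite group `G`, computed with
the regular representation `V`, which is faithful. -/
def essDim (K : Type u) (G : Type v) [Field K] [Group G] : Cardinal.{max u v} :=
  repEssDim (Representation.leftRegular K G)

end EssDim

end

/-! Let G = (ℤ/p)^r. A primitive p-th root of unity gives an injective character ψ of ℤ/p, so every
a in 𝔽_p^r gives a character g ↦ ψ(a ⬝ g) of G. As p is invertible in K, averaging splits every
representation of G into eigenspaces for these characters. Everything is done with eigenvectors
("weight vectors") and their weights a.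

Upper bound: G acts faithfully on V*, so there are r linear forms that are eigenvectors and whose
weights form a basis of 𝔽_p^r. Let E be the field they generate. Monomials in them realize every
weight, and one nonzero eigenvector of each weight gives a basis over the invariants, both of E and
of K(V). So both degrees are p^r, and the extension is defined over E^G, whose transcendence degree
is at most r (`exists_isDefinedOver_trdeg_le`).

Lower bound: if the extension is defined over E₀, the algebraic closure of E₀ in K(V) is G-stable
with faithful action, so it contains r eigenvectors with independent weights
(`IsDefinedOver.exists_weightVectors`). Such eigenvectors are algebraically independent
(`algebraicIndependent_of_isWeightVector`): in coordinates diagonalizing G, the weight of an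
eigenvector is the reduction of its leading exponent, so the leading exponents are independent
modulo p, hence over ℤ, and no cancellation of leading terms is possible in a polynomial relation.
-/

noncomputable section
namespace EssDim

/-! ### Eigenspace decomposition for (ℤ/pℤ)^r -/

section Weights

variable {p r : ℕ} {K : Type u} [Field K] {W : Type v} [AddCommGroup W] [Module K W]

/-- `w` is an eigenvector of the representation `τ` of `(ℤ/pℤ)^r` for the character
`g ↦ ψ (a ⬝ g)`. -/
def IsWeightVector (ψ : AddChar (ZMod p) K)
    (τ : Representation K (Multiplicative (Fin r → ZMod p)) W) (a : Fin r → ZMod p) (w : W) :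
    Prop :=
  ∀ g, τ g w = ψ (a ⬝ᵥ g.toAdd) • w

/-- The projection to the eigenspace of the character `g ↦ ψ (a ⬝ g)`, up to the scalar `p ^ r`. -/
def weightProj [NeZero p] (ψ : AddChar (ZMod p) K)
    (τ : Representation K (Multiplicative (Fin r → ZMod p)) W) (a : Fin r → ZMod p) : W →ₗ[K] W :=
  ∑ g : Fin r → ZMod p, ψ (-(a ⬝ᵥ g)) • τ (Multiplicative.ofAdd g)

variable {ψ : AddChar (ZMod p) K} {τ : Representation K (Multiplicative (Fin r → ZMod p)) W}

theorem weightProj_apply [NeZero p] (a : Fin r → ZMod p) (w : W) : weightProj ψ τ a w =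
    ∑ g : Fin r → ZMod p, ψ (-(a ⬝ᵥ g)) • τ (Multiplicative.ofAdd g) w := by
  simp [weightProj]

theorem isWeightVector_weightProj [NeZero p] (a : Fin r → ZMod p) (w : W) :
    IsWeightVector ψ τ a (weightProj ψ τ a w) := by
  intro g
  simp only [weightProj_apply, map_sum, map_smul, Finset.smul_sum, smul_smul,
    ← AddChar.map_add_eq_mul]
  refine Fintype.sum_equiv (Equiv.addLeft g.toAdd) _ _ fun h => ?_
  rw [Equiv.coe_addLeft, ofAdd_add, map_mul, dotProduct_add]
  congr 2
  ring

/-- A nontrivial character sums to zero over the group; injectivity of ψ makes a ↦ ψ(-(a ⬝ x))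
nontrivial, as a unit vector at a nonzero coordinate of x shows. -/
theorem sum_addChar_dotProduct [Fact p.Prime] (hψ : Function.Injective ψ) {x : Fin r → ZMod p}
    (hx : x ≠ 0) : ∑ a : Fin r → ZMod p, ψ (-(a ⬝ᵥ x)) = 0 := by
  obtain ⟨i, hi⟩ := Function.ne_iff.mp hx
  let χ : AddChar (Fin r → ZMod p) K :=
    { toFun := fun a => ψ (-(a ⬝ᵥ x))
      map_zero_eq_one' := by simp
      map_add_eq_mul' := fun a b => by
        rw [add_dotProduct, neg_add, AddChar.map_add_eq_mul] }
  have hχ : χ ≠ 1 := by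
    intro h
    have h1 : χ (Pi.single i 1) = 1 := by rw [h]; rfl
    have h2 : ψ (-(Pi.single i 1 ⬝ᵥ x)) = ψ 0 := by rw [AddChar.map_zero_eq_one]; exact h1
    have h3 := hψ h2
    simp at h3
    exact hi h3
  exact AddChar.sum_eq_zero_of_ne_one hχ

/-- Fourier inversion: after exchanging the sums, orthogonality leaves only the term of the identity
of the group. -/
theorem sum_weightProj [Fact p.Prime] (hψ : Function.Injective ψ) (w : W) :
    ∑ a, weightProj ψ τ a w = ((p : K) ^ r) • w := by
  simp only [weightProj_apply]
  rw [Finset.sum_comm]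
  simp only [← Finset.sum_smul]
  rw [Finset.sum_eq_single 0]
  · simp
  · intro g _ hg
    rw [sum_addChar_dotProduct hψ hg, zero_smul]
  · simp

theorem weightProj_mem [NeZero p] {U : Submodule K W} (hU : ∀ g, ∀ u ∈ U, τ g u ∈ U)
    (a : Fin r → ZMod p) {w : W} (hw : w ∈ U) : weightProj ψ τ a w ∈ U := by
  rw [weightProj_apply]
  exact U.sum_mem fun _ _ => U.smul_mem _ (hU _ _ hw)

theorem weightProj_of_isWeightVector_of_ne [Fact p.Prime] (hψ : Function.Injective ψ)
    {a b : Fin r → ZMod p} (hab : a ≠ b) {w : W} (hw : IsWeightVector ψ τ a w) :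
    weightProj ψ τ b w = 0 := by
  simp only [weightProj_apply, hw _, smul_smul, ← AddChar.map_add_eq_mul, ← Finset.sum_smul]
  rw [← zero_smul K w, ← sum_addChar_dotProduct hψ (sub_ne_zero.mpr hab.symm)]
  congr 1
  refine Finset.sum_congr rfl fun g _ => ?_
  rw [toAdd_ofAdd, dotProduct_comm g, sub_dotProduct]
  congr 1
  ring

theorem weightProj_of_isWeightVector [Fact p.Prime] (hψ : Function.Injective ψ)
    {a : Fin r → ZMod p} {w : W} (hw : IsWeightVector ψ τ a w) :
    weightProj ψ τ a w = ((p : K) ^ r) • w := by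
  rw [← sum_weightProj (τ := τ) hψ w]
  exact (Finset.sum_eq_single_of_mem a (Finset.mem_univ a) fun b _ hb =>
    weightProj_of_isWeightVector_of_ne hψ hb.symm hw).symm

/-- Eigenvectors for pairwise distinct characters that add up to zero all vanish. -/
theorem eq_zero_of_sum_weightVectors_eq_zero [Fact p.Prime] (hp : (p : K) ≠ 0)
    (hψ : Function.Injective ψ) {v : (Fin r → ZMod p) → W} (hv : ∀ a, IsWeightVector ψ τ a (v a))
    (hsum : ∑ a, v a = 0) (a : Fin r → ZMod p) : v a = 0 := by
  have h := congrArg (weightProj ψ τ a) hsum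
  rw [map_zero, map_sum, Finset.sum_eq_single a
    (fun b _ hb => weightProj_of_isWeightVector_of_ne hψ hb (hv b)) (by simp),
    weightProj_of_isWeightVector hψ (hv a)] at h
  exact (smul_eq_zero.mp h).resolve_left (pow_ne_zero _ hp)

/-- The components of w are combinations of its translates, so they stay in U. No finiteness of W is
required, which allows U to be an intermediate field viewed as a K-subspace. -/
theorem mem_span_weightVectors [Fact p.Prime] (hp : (p : K) ≠ 0) (hψ : Function.Injective ψ)
    {U : Submodule K W} (hU : ∀ g, ∀ u ∈ U, τ g u ∈ U) {w : W} (hw : w ∈ U) :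
    w ∈ Submodule.span K {v | v ∈ U ∧ v ≠ 0 ∧ ∃ a, IsWeightVector ψ τ a v} := by
  have h := sum_weightProj (τ := τ) hψ w
  have hpr : (p : K) ^ r ≠ 0 := pow_ne_zero _ hp
  rw [← inv_smul_smul₀ hpr w, ← h]
  refine Submodule.smul_mem _ _ (Submodule.sum_mem _ fun a _ => ?_)
  by_cases h0 : weightProj ψ τ a w = 0
  · rw [h0]; exact Submodule.zero_mem _
  · exact Submodule.subset_span
      ⟨weightProj_mem hU a hw, h0, a, isWeightVector_weightProj a w⟩

/-- A proper subspace lies in the kernel of a nonzero linear form, and every linear form on 𝔽_p^r is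
the dot product with some vector. -/
theorem span_eq_top_of_dotProduct_separating [Fact p.Prime] {S : Set (Fin r → ZMod p)}
    (hS : ∀ g : Fin r → ZMod p, (∀ a ∈ S, a ⬝ᵥ g = 0) → g = 0) :
    Submodule.span (ZMod p) S = ⊤ := by
  by_contra h
  obtain ⟨f, hf, hker⟩ := Submodule.exists_le_ker_of_lt_top _ (lt_top_iff_ne_top.mpr h)
  have key : ∀ a, f a = a ⬝ᵥ fun i => f (Pi.single i 1) := by
    intro a
    conv_lhs => rw [pi_eq_sum_univ' a]
    simp [dotProduct]
  have h0 := hS (fun i => f (Pi.single i 1)) fun a ha => by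
    rw [← key]; exact hker (Submodule.subset_span ha)
  apply hf
  refine LinearMap.ext fun a => ?_
  rw [key, h0, dotProduct_zero, LinearMap.zero_apply]

theorem exists_linearIndependent_of_span_eq_top [Fact p.Prime] {S : Set (Fin r → ZMod p)}
    (hS : Submodule.span (ZMod p) S = ⊤) :
    ∃ a : Fin r → Fin r → ZMod p, LinearIndependent (ZMod p) a ∧ ∀ i, a i ∈ S := by
  obtain ⟨b, hb, hspan, hli⟩ := exists_linearIndependent (ZMod p) S
  let B := Module.Basis.mk hli (by rw [Subtype.range_coe, hspan, hS])
  have hfin : Fintype b := Fintype.ofFinite b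
  have hcard : Fintype.card b = r := by
    rw [← Module.finrank_eq_card_basis B, Module.finrank_fin_fun]
  let e : Fin r ≃ b := (Fintype.equivFinOfCardEq hcard).symm
  exact ⟨fun i => e i, hli.comp e e.injective, fun i => hb (e i).2⟩

/-- An element g orthogonal to all weights of U fixes every eigenvector in U, hence all of U, so g =
1 by faithfulness. The weights therefore span 𝔽_p^r and contain a basis. -/
theorem exists_weightVectors_linearIndependent [Fact p.Prime] (hp : (p : K) ≠ 0)
    (hψ : Function.Injective ψ) {U : Submodule K W} (hU : ∀ g, ∀ u ∈ U, τ g u ∈ U)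
    (hf : ∀ g, (∀ u ∈ U, τ g u = u) → g = 1) :
    ∃ (w : Fin r → W) (a : Fin r → Fin r → ZMod p), LinearIndependent (ZMod p) a ∧
      ∀ i, w i ∈ U ∧ w i ≠ 0 ∧ IsWeightVector ψ τ (a i) (w i) := by
  have hS := span_eq_top_of_dotProduct_separating
    (S := {a : Fin r → ZMod p | ∃ w ∈ U, w ≠ 0 ∧ IsWeightVector ψ τ a w}) fun g hg => by
      have : Multiplicative.ofAdd g = 1 := by
        refine hf _ fun u hu => ?_
        have := mem_span_weightVectors hp hψ hU hu
        have hle : Submodule.span K {v | v ∈ U ∧ v ≠ 0 ∧ ∃ a, IsWeightVector ψ τ a v} ≤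
            LinearMap.eqLocus (τ (Multiplicative.ofAdd g)) LinearMap.id := by
          rw [Submodule.span_le]
          rintro v ⟨hvU, hv0, a, ha⟩
          rw [SetLike.mem_coe, LinearMap.mem_eqLocus, ha, toAdd_ofAdd, hg a ⟨v, hvU, hv0, ha⟩,
            AddChar.map_zero_eq_one, one_smul, LinearMap.id_apply]
        exact hle this
      exact this
  obtain ⟨a, hli, ha⟩ := exists_linearIndependent_of_span_eq_top hS
  choose w hw using ha
  exact ⟨w, a, hli, hw⟩

/-- A representation of `(ℤ/pℤ)^r` on a finite-dimensional space is diagonalizable. -/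
theorem exists_basis_weightVectors [Fact p.Prime] [FiniteDimensional K W] (hp : (p : K) ≠ 0)
    (hψ : Function.Injective ψ) (τ : Representation K (Multiplicative (Fin r → ZMod p)) W) :
    ∃ (n : ℕ) (b : Module.Basis (Fin n) K W) (a : Fin n → Fin r → ZMod p),
      ∀ i, IsWeightVector ψ τ (a i) (b i) := by
  have hspan : Submodule.span K {v | v ∈ (⊤ : Submodule K W) ∧ v ≠ 0 ∧
      ∃ a, IsWeightVector ψ τ a v} = ⊤ :=
    eq_top_iff.mpr fun w hw => mem_span_weightVectors hp hψ (fun _ _ _ => Submodule.mem_top) hw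
  obtain ⟨s, hs, hs', hli⟩ := exists_linearIndependent K {v | v ∈ (⊤ : Submodule K W) ∧ v ≠ 0 ∧
      ∃ a, IsWeightVector ψ τ a v}
  let B := Module.Basis.mk hli (by rw [Subtype.range_coe, hs', hspan])
  have : Finite s := Module.Finite.finite_basis B
  let e := Finite.equivFin s
  have h : ∀ i, ∃ a, IsWeightVector ψ τ a (B.reindex e i) := fun i => by
    rw [Module.Basis.reindex_apply, Module.Basis.mk_apply]
    exact (hs (e.symm i).2).2.2
  choose a ha using h
  exact ⟨_, B.reindex e, a, ha⟩

end Weights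

/-! ### Eigenvectors in field extensions; fields of definition -/

section GaloisWeights

variable {p r : ℕ} {K : Type u} [Field K] {L : Type v} [Field L] [Algebra K L]

/-- An action on a field extension by automorphisms, regarded as a representation. -/
def galoisRep {G : Type*} [Monoid G] (α : G →* (L ≃ₐ[K] L)) : Representation K G L where
  toFun g := (α g).toLinearMap
  map_one' := by ext; simp
  map_mul' g h := by ext; simp

@[simp]
theorem galoisRep_apply {G : Type*} [Monoid G] (α : G →* (L ≃ₐ[K] L)) (g : G) (x : L) :
    galoisRep α g x = α g x := rfl

theorem mem_fixedField_range_iff {G : Type*} [Group G] (α : G →* (L ≃ₐ[K] L)) {x : L} :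
    x ∈ IntermediateField.fixedField α.range ↔ ∀ g, α g x = x := by
  simp [IntermediateField.mem_fixedField_iff]

variable {ψ : AddChar (ZMod p) K} {α : Multiplicative (Fin r → ZMod p) →* (L ≃ₐ[K] L)}

theorem isWeightVector_zero_iff {x : L} : IsWeightVector ψ (galoisRep α) 0 x ↔
    x ∈ IntermediateField.fixedField α.range := by
  simp [IsWeightVector]

theorem isWeightVector_one : IsWeightVector ψ (galoisRep α) 0 (1 : L) := by
  simp [IsWeightVector]

theorem IsWeightVector.mul {a b : Fin r → ZMod p} {x y : L}
    (hx : IsWeightVector ψ (galoisRep α) a x) (hy : IsWeightVector ψ (galoisRep α) b y) :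
    IsWeightVector ψ (galoisRep α) (a + b) (x * y) := by
  intro g
  have hx' := hx g
  have hy' := hy g
  rw [galoisRep_apply] at *
  rw [map_mul, hx', hy', smul_mul_smul_comm, add_dotProduct, AddChar.map_add_eq_mul]

theorem IsWeightVector.inv {a : Fin r → ZMod p} {x : L}
    (hx : IsWeightVector ψ (galoisRep α) a x) : IsWeightVector ψ (galoisRep α) (-a) x⁻¹ := by
  intro g
  have hx' := hx g
  rw [galoisRep_apply] at *
  rw [map_inv₀, hx', Algebra.smul_def, Algebra.smul_def, mul_inv, neg_dotProduct,
    AddChar.map_neg_eq_inv, map_inv₀]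

theorem IsWeightVector.pow {a : Fin r → ZMod p} {x : L}
    (hx : IsWeightVector ψ (galoisRep α) a x) (n : ℕ) :
    IsWeightVector ψ (galoisRep α) (n • a) (x ^ n) := by
  induction n with
  | zero => simpa using isWeightVector_one
  | succ n ih => rw [pow_succ, succ_nsmul]; exact ih.mul hx

theorem IsWeightVector.prod {ι : Type*} {a : ι → Fin r → ZMod p} {x : ι → L} (s : Finset ι)
    (hx : ∀ i, IsWeightVector ψ (galoisRep α) (a i) (x i)) :
    IsWeightVector ψ (galoisRep α) (∑ i ∈ s, a i) (∏ i ∈ s, x i) := by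
  classical
  induction s using Finset.induction_on with
  | empty => simpa using isWeightVector_one
  | insert i s hi ih => rw [Finset.prod_insert hi, Finset.sum_insert hi]; exact (hx i).mul ih

/-- If the characters of `r` eigenvectors form a basis of the character group, then every character
occurs in the field that they generate. -/
theorem exists_weightVector_of_linearIndependent [Fact p.Prime] {x : Fin r → L}
    {a : Fin r → Fin r → ZMod p} (ha : LinearIndependent (ZMod p) a) (hx0 : ∀ i, x i ≠ 0)
    (hx : ∀ i, IsWeightVector ψ (galoisRep α) (a i) (x i)) {F : IntermediateField K L}
    (hF : ∀ i, x i ∈ F) (b : Fin r → ZMod p) :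
    ∃ m ∈ F, m ≠ 0 ∧ IsWeightVector ψ (galoisRep α) b m := by
  have hspan := ha.span_eq_top_of_card_eq_finrank' (by simp)
  have hb : b ∈ Submodule.span (ZMod p) (Set.range a) := hspan ▸ Submodule.mem_top
  obtain ⟨c, rfl⟩ := (Submodule.mem_span_range_iff_exists_fun _).mp hb
  refine ⟨∏ i, x i ^ (c i).val, prod_mem fun i _ => pow_mem (hF i) _,
    Finset.prod_ne_zero_iff.mpr fun i _ => pow_ne_zero _ (hx0 i), ?_⟩
  have h := IsWeightVector.prod Finset.univ fun i => (hx i).pow (c i).val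
  convert h using 3 with i
  rw [← Nat.cast_smul_eq_nsmul (ZMod p), ZMod.natCast_zmod_val]

theorem injective_of_forall_exists_weightVector (hψ : Function.Injective ψ)
    (hm : ∀ b, ∃ m : L, m ≠ 0 ∧ IsWeightVector ψ (galoisRep α) b m) : Function.Injective α := by
  rw [injective_iff_map_eq_one]
  intro g hg
  have h : g.toAdd = 0 := by
    refine dotProduct_eq_zero _ fun b => ?_
    obtain ⟨m, hm0, hm⟩ := hm b
    have h1 := hm g
    rw [galoisRep_apply, hg, AlgEquiv.one_apply] at h1
    have h2 : ψ (b ⬝ᵥ g.toAdd) = 1 := smul_left_injective K hm0 (by simpa using h1.symm)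
    rw [← AddChar.map_zero_eq_one ψ] at h2
    rw [dotProduct_comm]
    exact hψ h2
  exact h

theorem div_mem_fixedField {b : Fin r → ZMod p} {x y : L}
    (hx : IsWeightVector ψ (galoisRep α) b x) (hy : IsWeightVector ψ (galoisRep α) b y) :
    x / y ∈ IntermediateField.fixedField α.range := by
  rw [← isWeightVector_zero_iff (ψ := ψ), div_eq_mul_inv, ← add_neg_cancel b]
  exact hx.mul hy.inv

/-- When `m b` has weight b, each coefficient is a quotient of two eigenvectors of equal weight,
hence invariant. This is the expansion of y in the basis `m` over the invariants. -/
theorem eq_sum_div_mul [Fact p.Prime] (hp : (p : K) ≠ 0) (hψ : Function.Injective ψ)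
    {m : (Fin r → ZMod p) → L} (hm0 : ∀ b, m b ≠ 0) (y : L) :
    y = ∑ b, weightProj ψ (galoisRep α) b (((p : K) ^ r)⁻¹ • y) / m b * m b := by
  simp only [div_mul_cancel₀ _ (hm0 _)]
  rw [sum_weightProj hψ, smul_inv_smul₀ (pow_ne_zero _ hp)]

theorem weightProj_mem_intermediateField [NeZero p] {F : IntermediateField K L}
    (hF : ∀ g, ∀ x ∈ F, α g x ∈ F) (b : Fin r → ZMod p) {x : L} (hx : x ∈ F) :
    weightProj ψ (galoisRep α) b x ∈ F :=
  weightProj_mem (τ := galoisRep α) (U := F.toSubalgebra.toSubmodule) hF b hx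

theorem sup_fixedField_eq_top [Fact p.Prime] (hp : (p : K) ≠ 0) (hψ : Function.Injective ψ)
    {F : IntermediateField K L}
    (hm : ∀ b, ∃ m ∈ F, m ≠ 0 ∧ IsWeightVector ψ (galoisRep α) b m) :
    F ⊔ IntermediateField.fixedField α.range = ⊤ := by
  choose m hmF hm0 hm using hm
  refine eq_top_iff.mpr fun y _ => ?_
  rw [eq_sum_div_mul (α := α) hp hψ hm0 y]
  exact sum_mem fun b _ => mul_mem
    ((le_sup_right : _ ≤ F ⊔ IntermediateField.fixedField α.range)
      (div_mem_fixedField (isWeightVector_weightProj b _) (hm b)))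
    ((le_sup_left : F ≤ F ⊔ IntermediateField.fixedField α.range) (hmF b))

/-- One eigenvector of each weight gives a basis of F over its invariants `L₀ ⊓ F`: distinct weights
give independence, and the weight components of elements of F stay in F. It serves both for the
field generated by r eigenvectors and, with F = ⊤, for [L : L₀]. -/
theorem relrank_fixedField [Fact p.Prime] (hp : (p : K) ≠ 0) (hψ : Function.Injective ψ)
    {F : IntermediateField K L} (hF : ∀ g, ∀ x ∈ F, α g x ∈ F)
    (hm : ∀ b, ∃ m ∈ F, m ≠ 0 ∧ IsWeightVector ψ (galoisRep α) b m) :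
    (IntermediateField.fixedField α.range).relrank F = ((p ^ r : ℕ) : Cardinal) := by
  choose m hmF hm0 hm using hm
  set L₀ := IntermediateField.fixedField α.range with hL₀
  have hle : L₀ ⊓ F ≤ F := inf_le_right
  let v : (Fin r → ZMod p) → IntermediateField.extendScalars hle := fun b => ⟨m b, hmF b⟩
  have hli : LinearIndependent (L₀ ⊓ F : IntermediateField K L) v := by
    rw [Fintype.linearIndependent_iff]
    intro c hc b
    have hsum : ∑ b, (c b : L) * m b = 0 := by
      have := congrArg Subtype.val hc
      simpa [v, Algebra.smul_def] using this
    have hw : ∀ b, IsWeightVector ψ (galoisRep α) b ((c b : L) * m b) := fun b => by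
      have h := (isWeightVector_zero_iff (ψ := ψ).mpr (c b).2.1).mul (hm b)
      rwa [zero_add] at h
    have := eq_zero_of_sum_weightVectors_eq_zero hp hψ hw hsum b
    exact Subtype.ext ((mul_eq_zero.mp this).resolve_right (hm0 b))
  have hsp : ⊤ ≤ Submodule.span (L₀ ⊓ F : IntermediateField K L) (Set.range v) := by
    rintro ⟨y, hy⟩ -
    have hyF : y ∈ F := hy
    rw [Submodule.mem_span_range_iff_exists_fun]
    refine ⟨fun b => ⟨weightProj ψ (galoisRep α) b (((p : K) ^ r)⁻¹ • y) / m b,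
      div_mem_fixedField (isWeightVector_weightProj b _) (hm b),
      div_mem (weightProj_mem_intermediateField hF b (F.smul_mem hyF)) (hmF b)⟩, ?_⟩
    apply Subtype.ext
    refine Eq.trans ?_ (eq_sum_div_mul (α := α) hp hψ hm0 y).symm
    simp [v, Algebra.smul_def]
  have hrank := rank_eq_card_basis (Module.Basis.mk hli hsp)
  rw [Fintype.card_fun, ZMod.card, Fintype.card_fin] at hrank
  rw [← IntermediateField.inf_relrank_right, IntermediateField.relrank_eq_rank_of_le hle]
  exact hrank

open IntermediateField.algebraAdjoinAdjoin in
theorem trdeg_adjoin_range_le {n : ℕ} (x : Fin n → L) :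
    Algebra.trdeg K (IntermediateField.adjoin K (Set.range x)) ≤ (n : Cardinal) := by
  have h1 : Algebra.trdeg K (Algebra.adjoin K (Set.range x)) ≤ (n : Cardinal) := by
    rw [Algebra.adjoin_range_eq_range_aeval]
    have := lift_trdeg_le_of_surjective _
      (MvPolynomial.aeval (R := K) x).rangeRestrict_surjective
    rw [MvPolynomial.trdeg_of_isDomain] at this
    simpa using this
  have halg : Algebra.IsAlgebraic (Algebra.adjoin K (Set.range x))
    (IntermediateField.adjoin K (Set.range x)) := IsLocalization.isAlgebraic _
      (nonZeroDivisors (Algebra.adjoin K (Set.range x)))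
  have h2 := trdeg_add_eq K (Algebra.adjoin K (Set.range x))
    (A := IntermediateField.adjoin K (Set.range x))
  rw [trdeg_eq_zero (A := IntermediateField.adjoin K (Set.range x)), add_zero] at h2
  rw [← h2]
  exact h1

/-- If `r` eigenvectors have characters that form a basis of the character group, then the extension
is defined over the field of invariants of the field that they generate. -/
theorem exists_isDefinedOver_trdeg_le [Fact p.Prime] (hp : (p : K) ≠ 0) (hψ : Function.Injective ψ)
    {x : Fin r → L} {a : Fin r → Fin r → ZMod p} (ha : LinearIndependent (ZMod p) a)
    (hx0 : ∀ i, x i ≠ 0) (hx : ∀ i, IsWeightVector ψ (galoisRep α) (a i) (x i)) :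
    ∃ E₀ : IntermediateField K L, IsDefinedOver (IntermediateField.fixedField α.range) E₀ ∧
      Algebra.trdeg K E₀ ≤ (r : Cardinal) := by
  set L₀ := IntermediateField.fixedField α.range with hL₀
  set E := IntermediateField.adjoin K (Set.range x) with hE
  have hxE : ∀ i, x i ∈ E := fun i => IntermediateField.subset_adjoin _ _ ⟨i, rfl⟩
  have hstable : ∀ g, ∀ y ∈ E, α g y ∈ E := by
    intro g y hy
    have hle : E ≤ E.comap (α g).toAlgHom := by
      rw [hE, IntermediateField.adjoin_le_iff]
      rintro _ ⟨i, rfl⟩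
      have : α g (x i) ∈ E := by
        have h := hx i g
        rw [galoisRep_apply] at h
        rw [h]
        exact E.smul_mem (hxE i)
      exact this
    exact hle hy
  have hmE := exists_weightVector_of_linearIndependent ha hx0 hx hxE
  have hmtop := exists_weightVector_of_linearIndependent ha hx0 hx
    (F := ⊤) fun _ => IntermediateField.mem_top
  -- The witness is the field of invariants of E; both degrees to be compared are p ^ r.
  have hdef : IsDefinedOver L₀ (L₀ ⊓ E) := by
    refine ⟨inf_le_left, E, inf_le_right, ?_, sup_fixedField_eq_top hp hψ hmE⟩
    rw [IntermediateField.inf_relrank_right, relrank_fixedField hp hψ hstable hmE,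
      ← IntermediateField.relrank_top_right,
      relrank_fixedField hp hψ (fun _ _ _ => IntermediateField.mem_top) hmtop]
  refine ⟨L₀ ⊓ E, hdef, ?_⟩
  calc Algebra.trdeg K (L₀ ⊓ E : IntermediateField K L) ≤ Algebra.trdeg K E := trdeg_le_of_injective
        (IntermediateField.inclusion inf_le_right)
        (IntermediateField.inclusion_injective inf_le_right)
    _ ≤ r := trdeg_adjoin_range_le x

/-- If the extension `L / L^G` is defined over `E₀`, then the algebraic closure of `E₀` in `L`
contains eigenvectors whose characters form a basis of the character group. -/
theorem IsDefinedOver.exists_weightVectors [Fact p.Prime] (hp : (p : K) ≠ 0)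
    (hψ : Function.Injective ψ)
    (hm : ∀ b, ∃ m : L, m ≠ 0 ∧ IsWeightVector ψ (galoisRep α) b m)
    {E₀ : IntermediateField K L}
    (hE₀ : IsDefinedOver (IntermediateField.fixedField α.range) E₀) :
    ∃ (y : Fin r → L) (a : Fin r → Fin r → ZMod p), LinearIndependent (ZMod p) a ∧
      ∀ i, IsAlgebraic E₀ (y i) ∧ y i ≠ 0 ∧ IsWeightVector ψ (galoisRep α) (a i) (y i) := by
  obtain ⟨hle, E, hE₀E, hrank, hsup⟩ := hE₀
  -- E need not be stable under the group. The algebraic closure of E₀ is, and it contains E because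
  -- [E : E₀] = [L : L₀] = p ^ r is finite.
  let E' : IntermediateField K L := (algebraicClosure E₀ L).restrictScalars K
  have hmem : ∀ {x : L}, x ∈ E' ↔ IsAlgebraic E₀ x := mem_algebraicClosure_iff
  have hEE' : E ≤ E' := by
    intro x hx
    rw [hmem]
    have hfin : FiniteDimensional E₀ (IntermediateField.extendScalars hE₀E) := by
      rw [← IntermediateField.relrank_top_right, relrank_fixedField hp hψ
        (fun _ _ _ => IntermediateField.mem_top)
        (fun b => (hm b).imp fun m h => ⟨IntermediateField.mem_top, h⟩),
        IntermediateField.relrank_eq_rank_of_le hE₀E] at hrank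
      rw [FiniteDimensional, ← Module.rank_lt_aleph0_iff, hrank]
      exact Cardinal.natCast_lt_aleph0
    exact (IsAlgebraic.of_finite E₀
      (⟨x, hx⟩ : IntermediateField.extendScalars hE₀E)).algHom
        (IntermediateField.extendScalars hE₀E).val
  have hstable : ∀ g, ∀ y ∈ E'.toSubalgebra.toSubmodule,
      galoisRep α g y ∈ E'.toSubalgebra.toSubmodule := by
    intro g y hy
    -- Since E₀ consists of invariants, `α g` is E₀-linear and preserves algebraicity over E₀.
    let β : L →ₐ[E₀] L :=
      { (α g : L →+* L) with
        commutes' := fun c => (mem_fixedField_range_iff α).mp (hle c.2) g }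
    exact hmem.mpr ((hmem.mp hy).algHom β)
  have hfaithful : ∀ g, (∀ u ∈ E'.toSubalgebra.toSubmodule, galoisRep α g u = u) → g = 1 := by
    intro g hg
    apply injective_of_forall_exists_weightVector hψ hm
    rw [map_one]
    -- If g is trivial on E', then it fixes both E and L₀, hence their compositum L.
    have htop : E ⊔ IntermediateField.fixedField α.range ≤
        IntermediateField.fixedField (Subgroup.zpowers (α g)) := by
      refine sup_le (fun x hx => ?_) (fun x hx => ?_)
      · rw [IntermediateField.mem_fixedField_iff]
        have hs : α g ∈ MulAction.stabilizer (L ≃ₐ[K] L) x := hg x (hEE' hx)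
        exact fun f hf => (Subgroup.zpowers_le.mpr hs) hf
      · exact IntermediateField.fixedField_antitone
          (Subgroup.zpowers_le.mpr (MonoidHom.mem_range.mpr ⟨g, rfl⟩)) hx
    ext x
    have hx : x ∈ IntermediateField.fixedField (Subgroup.zpowers (α g)) :=
      htop (hsup ▸ IntermediateField.mem_top)
    exact (IntermediateField.mem_fixedField_iff _ _).mp hx _ (Subgroup.mem_zpowers _)
  obtain ⟨y, a, ha, hy⟩ := exists_weightVectors_linearIndependent hp hψ hstable hfaithful
  exact ⟨y, a, ha, fun i => ⟨hmem.mp (hy i).1, (hy i).2⟩⟩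

theorem trdeg_eq_of_isAlgebraic (K : Type*) (F M : Type v) [Field K] [Field F] [Field M]
    [Algebra K F] [Algebra K M] [Algebra F M] [IsScalarTower K F M] [Algebra.IsAlgebraic F M] :
    Algebra.trdeg K F = Algebra.trdeg K M := by
  rw [← trdeg_add_eq K F (A := M), trdeg_eq_zero (R := F), add_zero]

/-- The `y i` lie in the algebraic closure of E₀ in L, which has the same transcendence degree as
E₀. -/
theorem AlgebraicIndependent.le_trdeg_of_isAlgebraic {n : ℕ} {y : Fin n → L}
    (hy : AlgebraicIndependent K y) {E₀ : IntermediateField K L}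
    (halg : ∀ i, IsAlgebraic E₀ (y i)) : (n : Cardinal) ≤ Algebra.trdeg K E₀ := by
  let z : Fin n → algebraicClosure E₀ L := fun i => ⟨y i, mem_algebraicClosure_iff.mpr (halg i)⟩
  have hz : AlgebraicIndependent K z :=
    AlgebraicIndependent.of_comp ((algebraicClosure E₀ L).val.restrictScalars K) hy
  rw [trdeg_eq_of_isAlgebraic K E₀ (algebraicClosure E₀ L)]
  simpa using hz.lift_cardinalMk_le_trdeg

end GaloisWeights

/-! ### Leading exponents and algebraic independence -/

section LeadingExponents

/-- Integral relations between vectors that become linearly independent modulo `p` are trivial. -/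
theorem eq_zero_of_sum_zsmul_eq_zero {p : ℕ} [Fact p.Prime] {ι M N : Type*} [Fintype ι]
    [AddCommGroup M] [IsAddTorsionFree M] [AddCommGroup N] [Module (ZMod p) N] (φ : M →+ N)
    {v : ι → M} (hv : LinearIndependent (ZMod p) (φ ∘ v)) {c : ι → ℤ}
    (hc : ∑ i, c i • v i = 0) : c = 0 := by
  cases isEmpty_or_nonempty ι
  · exact Subsingleton.elim _ _
  -- A nonzero relation can be divided by the gcd of its coefficients, as M is torsion-free. The new
  -- coefficients d have gcd 1, yet reduction modulo p makes p divide all of them.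
  obtain ⟨d, hd, hgcd⟩ := Finset.extract_gcd c (Finset.univ_nonempty (α := ι))
  by_cases h0 : Finset.univ.gcd c = 0
  · ext i
    rw [hd i (Finset.mem_univ i), h0, zero_mul, Pi.zero_apply]
  have hsum : ∑ i, d i • v i = 0 := by
    have h : Finset.univ.gcd c • ∑ i, d i • v i = 0 := by
      rw [Finset.smul_sum, ← hc]
      exact Finset.sum_congr rfl fun i hi => by rw [smul_smul, ← hd i hi]
    exact (smul_eq_zero.mp h).resolve_left h0
  have hmod : ∑ i, (d i : ZMod p) • (φ ∘ v) i = 0 := by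
    have h := congrArg φ hsum
    rw [map_sum, map_zero] at h
    rw [← h]
    exact Finset.sum_congr rfl fun i _ => by
      rw [map_zsmul, Int.cast_smul_eq_zsmul, Function.comp_apply]
  have hdvd : (p : ℤ) ∣ Finset.univ.gcd d := Finset.dvd_gcd fun i _ =>
    (ZMod.intCast_zmod_eq_zero_iff_dvd _ p).mp (Fintype.linearIndependent_iff.mp hv _ hmod i)
  rw [hgcd] at hdvd
  have hp1 := Int.eq_one_of_dvd_one (Int.natCast_nonneg p) hdvd
  exact absurd (by exact_mod_cast hp1 : p = 1) (Nat.Prime.one_lt Fact.out).ne'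

/-- The leading term of the summand of largest degree has nothing to cancel against. -/
theorem sum_ne_zero_of_degree_injOn {σ ι K : Type*} [CommSemiring K] (m : MonomialOrder σ)
    {s : Finset ι} (hs : s.Nonempty) {F : ι → MvPolynomial σ K} (hF : ∀ i ∈ s, F i ≠ 0)
    (hinj : Set.InjOn (fun i => m.degree (F i)) s) : ∑ i ∈ s, F i ≠ 0 := by
  obtain ⟨i, hi, hmax⟩ := s.exists_max_image (fun i => m.toSyn (m.degree (F i))) hs
  intro h
  have hc := congrArg (MvPolynomial.coeff (m.degree (F i))) h
  rw [MvPolynomial.coeff_sum, Finset.sum_eq_single_of_mem i hi, MvPolynomial.coeff_zero] at hc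
  · exact hF i hi (m.coeff_degree_eq_zero_iff.mp hc)
  · intro j hj hji
    refine m.coeff_eq_zero_of_lt (lt_of_le_of_ne (hmax j hj) fun he => ?_)
    exact hji (hinj hj hi (m.toSyn.injective he))

variable {σ : Type*} {K : Type u} [Field K] {L : Type v} [Field L] [Algebra K L]

/-- Fractions of polynomials are algebraically independent if their leading exponents are
linearly independent. -/
theorem algebraicIndependent_of_leadingExponents {n : ℕ} (m : MonomialOrder σ)
    {j : MvPolynomial σ K →ₐ[K] L} (hj : Function.Injective j) {y : Fin n → L}
    {f h : Fin n → MvPolynomial σ K} (hf0 : ∀ i, f i ≠ 0) (hh0 : ∀ i, h i ≠ 0)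
    (hy : ∀ i, y i * j (h i) = j (f i))
    (hli : ∀ c : Fin n → ℤ, (∀ s, ∑ i, c i * ((m.degree (f i) s : ℤ) - m.degree (h i) s) = 0) →
      c = 0) :
    AlgebraicIndependent K y := by
  rw [algebraicIndependent_iff]
  intro P hP
  by_contra hP0
  set N := P.totalDegree
  -- Multiplying the relation P(y) = 0 by every denominator `h i` to the power N turns the term of
  -- exponent e into the polynomial `F e`. Since e i ≤ N on the support, the truncated subtraction
  -- is exact.
  let F : (Fin n →₀ ℕ) → MvPolynomial σ K := fun e =>
    MvPolynomial.C (P.coeff e) * ∏ i, (f i ^ e i * h i ^ (N - e i))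
  have hle : ∀ e ∈ P.support, ∀ i, e i ≤ N := fun e he i =>
    (MvPolynomial.monomial_le_degreeOf i he).trans (MvPolynomial.degreeOf_le_totalDegree P i)
  have hprod0 : ∀ e : Fin n →₀ ℕ, ∀ i, f i ^ e i * h i ^ (N - e i) ≠ 0 := fun e i =>
    mul_ne_zero (pow_ne_zero _ (hf0 i)) (pow_ne_zero _ (hh0 i))
  have hdeg : ∀ e ∈ P.support, m.degree (F e) =
      ∑ i, (e i • m.degree (f i) + (N - e i) • m.degree (h i)) := by
    intro e he
    have hc : P.coeff e ≠ 0 := MvPolynomial.mem_support_iff.mp he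
    rw [m.degree_mul (by simpa using hc) (Finset.prod_ne_zero_iff.mpr fun i _ => hprod0 e i),
      m.degree_C, zero_add, m.degree_prod fun i _ => hprod0 e i]
    refine Finset.sum_congr rfl fun i _ => ?_
    rw [m.degree_mul (pow_ne_zero _ (hf0 i)) (pow_ne_zero _ (hh0 i)), m.degree_pow, m.degree_pow]
  refine sum_ne_zero_of_degree_injOn m (s := P.support) (F := F)
    (MvPolynomial.support_nonempty.mpr hP0) (fun e he => ?_) (fun e he e' he' hee' => ?_) ?_
  · exact mul_ne_zero (by simpa using he)
      (Finset.prod_ne_zero_iff.mpr fun i _ => hprod0 e i)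
  · simp only [hdeg e he, hdeg e' he'] at hee'
    -- In the difference of the two degrees the contributions of N cancel, which leaves an integral
    -- relation between the leading exponents of the fractions.
    have h0 := hli (fun i => (e i : ℤ) - e' i) fun s => by
      have hs := DFunLike.congr_fun hee' s
      simp only [Finsupp.coe_finsetSum, Finset.sum_apply, Finsupp.coe_add, Finsupp.coe_smul,
        Pi.add_apply, Pi.smul_apply, smul_eq_mul] at hs
      have hs' := congrArg (Nat.cast : ℕ → ℤ) hs
      push_cast at hs'
      rw [← sub_eq_zero, ← Finset.sum_sub_distrib] at hs'
      rw [← hs']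
      refine Finset.sum_congr rfl fun i _ => ?_
      rw [Nat.cast_sub (hle e he i), Nat.cast_sub (hle e' he' i)]
      ring
    ext i
    have := congrFun h0 i
    simp only [Pi.zero_apply] at this
    omega
  · apply hj
    rw [map_zero, map_sum, ← zero_mul (∏ i, j (h i) ^ N), ← hP, MvPolynomial.aeval_def,
      MvPolynomial.eval₂_eq', Finset.sum_mul]
    refine Finset.sum_congr rfl fun e he => ?_
    rw [map_mul, map_prod, MvPolynomial.algHom_C, mul_assoc, ← Finset.prod_mul_distrib]
    congr 1
    refine Finset.prod_congr rfl fun i _ => ?_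
    rw [map_mul, map_pow, map_pow, ← hy i, mul_pow, mul_assoc, ← pow_add,
      Nat.add_sub_cancel' (hle e he i)]

/-- The endomorphism of a polynomial ring that scales the variables. -/
def scaleVars (c : σ → K) : MvPolynomial σ K →ₐ[K] MvPolynomial σ K :=
  MvPolynomial.aeval fun i => MvPolynomial.C (c i) * MvPolynomial.X i

@[simp]
theorem scaleVars_X (c : σ → K) (i : σ) :
    scaleVars c (MvPolynomial.X i) = MvPolynomial.C (c i) * MvPolynomial.X i := by
  simp [scaleVars]

theorem coeff_scaleVars (c : σ → K) (f : MvPolynomial σ K) (e : σ →₀ ℕ) :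
    (scaleVars c f).coeff e = (e.prod fun i k => c i ^ k) * f.coeff e := by
  classical
  induction f using MvPolynomial.induction_on' with
  | monomial d b =>
    have h : scaleVars c (MvPolynomial.monomial d b) =
        MvPolynomial.monomial d ((d.prod fun i k => c i ^ k) * b) := by
      rw [scaleVars, MvPolynomial.aeval_monomial, MvPolynomial.algebraMap_eq,
        MvPolynomial.monomial_eq (s := d)]
      simp only [mul_pow, Finsupp.prod_mul, ← map_pow, MvPolynomial.C_mul]
      rw [Finsupp.prod, Finsupp.prod, ← map_prod, ← Finsupp.prod]
      ring
    rw [h, MvPolynomial.coeff_monomial, MvPolynomial.coeff_monomial]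
    split_ifs with hde
    · rw [hde]
    · rw [mul_zero]
  | add f g hf hg => rw [map_add, MvPolynomial.coeff_add, hf, hg, MvPolynomial.coeff_add, mul_add]

/-- Scaling by nonzero constants multiplies each coefficient by a unit, so the support is unchanged.
-/
theorem degree_scaleVars (m : MonomialOrder σ) {c : σ → K} (hc : ∀ i, c i ≠ 0)
    (f : MvPolynomial σ K) : m.degree (scaleVars c f) = m.degree f := by
  have hsupp : (scaleVars c f).support = f.support := by
    ext e
    rw [MvPolynomial.mem_support_iff, MvPolynomial.mem_support_iff, coeff_scaleVars,
      mul_ne_zero_iff]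
    exact and_iff_right (Finset.prod_ne_zero_iff.mpr fun i _ => pow_ne_zero _ (hc i))
  rw [MonomialOrder.degree, MonomialOrder.degree, hsupp]

theorem leadingCoeff_scaleVars (m : MonomialOrder σ) {c : σ → K} (hc : ∀ i, c i ≠ 0)
    (f : MvPolynomial σ K) : m.leadingCoeff (scaleVars c f) =
      ((m.degree f).prod fun i k => c i ^ k) * m.leadingCoeff f := by
  rw [MonomialOrder.leadingCoeff, degree_scaleVars m hc, coeff_scaleVars]
  rfl

/-- The character of a monomial in eigenvectors with characters `a`. -/
def monomialWeight {p r : ℕ} [Fintype σ] (a : σ → Fin r → ZMod p) :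
    (σ → ℤ) →+ (Fin r → ZMod p) where
  toFun e := ∑ s, e s • a s
  map_zero' := by simp
  map_add' e e' := by simp [add_smul, Finset.sum_add_distrib]

theorem monomialWeight_apply {p r : ℕ} [Fintype σ] (a : σ → Fin r → ZMod p) (e : σ → ℤ) :
    monomialWeight a e = ∑ s, e s • a s := rfl

/-- The left side is the factor by which g scales the monomial of exponent e, so the monomial has
weight `monomialWeight a e`. -/
theorem prod_addChar_dotProduct_pow {p r : ℕ} [NeZero p] [Fintype σ] (ψ : AddChar (ZMod p) K)
    (a : σ → Fin r → ZMod p) (g : Fin r → ZMod p) (e : σ →₀ ℕ) :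
    (e.prod fun i k => ψ (a i ⬝ᵥ g) ^ k) = ψ (monomialWeight a (fun s => (e s : ℤ)) ⬝ᵥ g) := by
  rw [Finsupp.prod_fintype _ _ fun i => pow_zero _, monomialWeight_apply, sum_dotProduct]
  have h := map_prod ψ.toMonoidHom
    (fun i => Multiplicative.ofAdd (((e i : ℤ) • a i) ⬝ᵥ g)) Finset.univ
  rw [← ofAdd_sum] at h
  simp only [AddChar.toMonoidHom_apply, toAdd_ofAdd] at h
  rw [h]
  refine Finset.prod_congr rfl fun i _ => ?_
  rw [natCast_zsmul, smul_dotProduct, AddChar.map_nsmul_eq_pow]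

/-- The character of an eigenvector can be read off from the leading exponents of a numerator and
a denominator. -/
theorem IsWeightVector.monomialWeight_degree_sub {p r : ℕ} [NeZero p] [Fintype σ]
    (m : MonomialOrder σ) {ψ : AddChar (ZMod p) K} (hψ : Function.Injective ψ)
    {α : Multiplicative (Fin r → ZMod p) →* (L ≃ₐ[K] L)}
    {j : MvPolynomial σ K →ₐ[K] L} (hj : Function.Injective j) {a : σ → Fin r → ZMod p}
    (hα : ∀ g f, α g (j f) = j (scaleVars (fun i => ψ (a i ⬝ᵥ g.toAdd)) f))
    {b : Fin r → ZMod p} {y : L} (hb : IsWeightVector ψ (galoisRep α) b y)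
    {f h : MvPolynomial σ K} (hf0 : f ≠ 0) (hh0 : h ≠ 0) (hy : y * j h = j f) :
    monomialWeight a (fun s => (m.degree f s : ℤ) - m.degree h s) = b := by
  have hψ0 : ∀ x, ψ x ≠ 0 := fun x => (ψ.val_isUnit x).ne_zero
  have hsplit : monomialWeight a (fun s => (m.degree f s : ℤ) - m.degree h s) =
      monomialWeight a (fun s => (m.degree f s : ℤ)) -
        monomialWeight a (fun s => (m.degree h s : ℤ)) := map_sub (monomialWeight a) _ _
  rw [hsplit, sub_eq_iff_eq_add]
  refine dotProduct_eq _ _ fun g => ?_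
  have hc : ∀ i, ψ (a i ⬝ᵥ g) ≠ 0 := fun i => hψ0 _
  -- The eigenvector equation for y = f / h with the denominators cleared.
  have hpoly : scaleVars (fun i => ψ (a i ⬝ᵥ g)) f * h =
      MvPolynomial.C (ψ (b ⬝ᵥ g)) * (f * scaleVars (fun i => ψ (a i ⬝ᵥ g)) h) := by
    apply hj
    have h1 := hα (Multiplicative.ofAdd g) f
    have h2 := hα (Multiplicative.ofAdd g) h
    have h3 := hb (Multiplicative.ofAdd g)
    rw [galoisRep_apply] at h3
    rw [toAdd_ofAdd] at h1 h2 h3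
    rw [map_mul, map_mul, map_mul, ← h1, ← h2, ← hy, map_mul, h3, MvPolynomial.algHom_C,
      Algebra.smul_def]
    ring
  -- The leading coefficients of f and h occur on both sides and cancel; what remains compares the
  -- values of ψ at the weights of the two leading monomials and at b.
  have hlc := congrArg m.leadingCoeff hpoly
  rw [m.leadingCoeff_mul, m.leadingCoeff_mul, m.leadingCoeff_mul, m.leadingCoeff_C,
    leadingCoeff_scaleVars m hc, leadingCoeff_scaleVars m hc, prod_addChar_dotProduct_pow,
    prod_addChar_dotProduct_pow] at hlc
  have hf' := m.leadingCoeff_ne_zero_iff.mpr hf0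
  have hh' := m.leadingCoeff_ne_zero_iff.mpr hh0
  apply hψ
  rw [add_dotProduct, AddChar.map_add_eq_mul]
  apply mul_right_cancel₀ (mul_ne_zero hf' hh')
  linear_combination hlc

/-- Eigenvectors with linearly independent characters in the fraction field of a polynomial ring in
eigenvectors are algebraically independent. -/
theorem algebraicIndependent_of_isWeightVector {p r n : ℕ} [Fact p.Prime] [Fintype σ]
    (m : MonomialOrder σ) {ψ : AddChar (ZMod p) K} (hψ : Function.Injective ψ)
    {α : Multiplicative (Fin r → ZMod p) →* (L ≃ₐ[K] L)}
    {j : MvPolynomial σ K →ₐ[K] L} (hj : Function.Injective j)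
    (hfrac : ∀ y, ∃ f h, h ≠ 0 ∧ y * j h = j f) {a : σ → Fin r → ZMod p}
    (hα : ∀ g f, α g (j f) = j (scaleVars (fun i => ψ (a i ⬝ᵥ g.toAdd)) f))
    {b : Fin n → Fin r → ZMod p} (hb : LinearIndependent (ZMod p) b) {y : Fin n → L}
    (hy0 : ∀ i, y i ≠ 0) (hy : ∀ i, IsWeightVector ψ (galoisRep α) (b i) (y i)) :
    AlgebraicIndependent K y := by
  choose f h hh0 hfh using fun i => hfrac (y i)
  have hf0 : ∀ i, f i ≠ 0 := fun i hf => by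
    have hi := hfh i
    rw [hf, map_zero] at hi
    exact mul_ne_zero (hy0 i) ((map_ne_zero_iff j hj).mpr (hh0 i)) hi
  refine algebraicIndependent_of_leadingExponents m hj hf0 hh0 hfh fun c hc => ?_
  let v : Fin n → σ → ℤ := fun i s => (m.degree (f i) s : ℤ) - m.degree (h i) s
  have hv : ∀ i, monomialWeight a (v i) = b i := fun i =>
    (hy i).monomialWeight_degree_sub m hψ hj hα (hf0 i) (hh0 i) (hfh i)
  refine eq_zero_of_sum_zsmul_eq_zero (p := p) (monomialWeight a) (v := v) ?_ ?_
  · rwa [show monomialWeight a ∘ v = b from funext hv]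
  · ext s
    simpa [v] using hc s

end LeadingExponents

/-! ### The function field K(V) and the essential dimension -/

section Main

variable {K : Type u} {G : Type v} {V : Type w} [Field K] [Group G] [AddCommGroup V] [Module K V]

theorem funFieldAut_algebraMap (ρ : Representation K G V) (g : G) (f : CoordRing K V) :
    funFieldAut ρ g (algebraMap _ (FunField K V) f) =
      algebraMap _ (FunField K V) (coordRingEnd ρ g f) :=
  IsFractionRing.fieldEquivOfAlgEquiv_algebraMap K (FunField K V) (FunField K V)
    (coordRingAut ρ g) f

theorem coordRingEnd_ι (ρ : Representation K G V) (g : G) (φ : Module.Dual K V) :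
    coordRingEnd ρ g (SymmetricAlgebra.ι K _ φ) = SymmetricAlgebra.ι K _ (ρ.dual g φ) :=
  SymmetricAlgebra.lift_ι_apply _ _

/-- In coordinates the basis vectors go to the variables, which are linearly independent. This keeps
nonzero eigenvectors in V* nonzero in K(V). -/
theorem ι_injective : Function.Injective (SymmetricAlgebra.ι K V) := by
  let b := Module.Basis.ofVectorSpace K V
  have h : (SymmetricAlgebra.equivMvPolynomial b).toLinearMap ∘ₗ SymmetricAlgebra.ι K V =
      (Finsupp.linearCombination K MvPolynomial.X) ∘ₗ b.repr.toLinearMap :=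
    b.ext fun i => by simp
  have hX : LinearIndependent K (MvPolynomial.X :
      Module.Basis.ofVectorSpaceIndex K V → MvPolynomial (Module.Basis.ofVectorSpaceIndex K V) K) :=
    MvPolynomial.linearIndependent_X _ _
  have hinj : Function.Injective
      ((SymmetricAlgebra.equivMvPolynomial b).toLinearMap ∘ₗ SymmetricAlgebra.ι K V) := by
    rw [h, LinearMap.coe_comp]
    exact Function.Injective.comp hX b.repr.injective
  exact fun x y hxy => hinj (congrArg (SymmetricAlgebra.equivMvPolynomial b) hxy)

theorem dual_injective {ρ : Representation K G V} (hρ : Function.Injective ρ) :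
    Function.Injective ρ.dual := by
  intro g h hgh
  have key : ρ g⁻¹ = ρ h⁻¹ := by
    ext v
    refine Module.forall_dual_apply_eq_zero_iff K _ |>.mp (fun φ => ?_) |> sub_eq_zero.mp
    have := congrArg (fun T : Module.End K (Module.Dual K V) => T φ v) hgh
    simp only [Representation.dual_apply, Module.Dual.transpose_apply] at this
    simpa [sub_eq_zero] using this
  exact inv_injective (hρ key)

theorem repEssDim_eq {p r : ℕ} [Fact p.Prime] (hp : (p : K) ≠ 0)
    (hζ : ∃ ζ : K, IsPrimitiveRoot ζ p) [FiniteDimensional K V]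
    {ρ : Representation K (Multiplicative (Fin r → ZMod p)) V} (hρ : Function.Injective ρ) :
    repEssDim ρ = (r : Cardinal) := by
  obtain ⟨ζ, hζ⟩ := hζ
  let ψ : AddChar (ZMod p) K := AddChar.zmodChar p hζ.pow_eq_one
  have hψ : Function.Injective ψ := by
    intro x y hxy
    rw [AddChar.zmodChar_apply, AddChar.zmodChar_apply] at hxy
    exact ZMod.val_injective p (hζ.pow_inj x.val_lt y.val_lt hxy)
  have hι : Function.Injective fun φ : Module.Dual K V =>
      algebraMap (CoordRing K V) (FunField K V) (SymmetricAlgebra.ι K _ φ) :=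
    (IsFractionRing.injective _ _).comp ι_injective
  have hweight : ∀ {a : Fin r → ZMod p} {φ : Module.Dual K V}, IsWeightVector ψ ρ.dual a φ →
      IsWeightVector ψ (galoisRep (funFieldAut ρ)) a
        (algebraMap (CoordRing K V) (FunField K V) (SymmetricAlgebra.ι K _ φ)) := by
    intro a φ h g
    rw [galoisRep_apply, funFieldAut_algebraMap, coordRingEnd_ι, h g, map_smul]
    exact map_smul (IsScalarTower.toAlgHom K (CoordRing K V) (FunField K V)) _ _
  -- These r linear forms give the upper bound, and their monomials show that every weight occurs in
  -- K(V).
  obtain ⟨φ, a, ha, hφ⟩ := exists_weightVectors_linearIndependent (τ := ρ.dual) hp hψ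
    (U := ⊤) (fun _ _ _ => Submodule.mem_top) fun g hg => dual_injective hρ (by
      rw [map_one]
      exact LinearMap.ext fun φ => hg φ Submodule.mem_top)
  have hx0 : ∀ i, algebraMap (CoordRing K V) (FunField K V)
      (SymmetricAlgebra.ι K _ (φ i)) ≠ 0 := fun i h =>
    (hφ i).2.1 (hι (by simpa using h))
  have hx := fun i => hweight (hφ i).2.2
  obtain ⟨E₁, hE₁, hE₁r⟩ := exists_isDefinedOver_trdeg_le hp hψ ha hx0 hx
  have hmem : Algebra.trdeg K E₁ ∈ {d | ∃ E₀ : IntermediateField K (FunField K V),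
      IsDefinedOver (funFieldInvariants ρ) E₀ ∧ Algebra.trdeg K E₀ = d} := ⟨E₁, hE₁, rfl⟩
  refine le_antisymm ((csInf_le' hmem).trans hE₁r) (le_csInf ⟨_, hmem⟩ ?_)
  rintro _ ⟨E₀, hE₀, rfl⟩
  obtain ⟨y, b, hb, hy⟩ := hE₀.exists_weightVectors hp hψ fun c =>
    (exists_weightVector_of_linearIndependent ha hx0 hx
      (F := ⊤) (fun _ => IntermediateField.mem_top) c).imp fun _ h => h.2
  -- For the lower bound a full eigenbasis of V* is needed, with possibly repeated weights: in these
  -- coordinates the group acts on K[V] by scaling variables.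
  obtain ⟨n, B, c, hc⟩ := exists_basis_weightVectors hp hψ ρ.dual
  let e := SymmetricAlgebra.equivMvPolynomial B
  let j : MvPolynomial (Fin n) K →ₐ[K] FunField K V :=
    (IsScalarTower.toAlgHom K (CoordRing K V) (FunField K V)).comp e.symm.toAlgHom
  have hj : Function.Injective j :=
    (IsFractionRing.injective (CoordRing K V) (FunField K V)).comp e.symm.injective
  have hj_apply : ∀ f, j f = algebraMap (CoordRing K V) (FunField K V) (e.symm f) := fun _ => rfl
  -- Any monomial order would do in place of `MonomialOrder.lex`.
  refine AlgebraicIndependent.le_trdeg_of_isAlgebraic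
    (algebraicIndependent_of_isWeightVector MonomialOrder.lex hψ hj (fun z => ?_) (a := c)
      (fun g f => ?_) hb (fun i => (hy i).2.1) fun i => (hy i).2.2) fun i => (hy i).1
  · obtain ⟨f, h, hh, rfl⟩ := IsFractionRing.div_surjective (CoordRing K V) z
    have hh0 : h ≠ 0 := nonZeroDivisors.ne_zero hh
    refine ⟨e f, e h, by simpa using hh0, ?_⟩
    rw [hj_apply, hj_apply, e.symm_apply_apply, e.symm_apply_apply, div_mul_cancel₀]
    exact (map_ne_zero_iff _ (IsFractionRing.injective _ _)).mpr hh0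
  · have hcomp : ((funFieldAut ρ g).toAlgHom.comp j) =
        j.comp (scaleVars fun i => ψ (c i ⬝ᵥ g.toAdd)) := by
      refine MvPolynomial.algHom_ext fun i => ?_
      have h := hweight (hc i) g
      rw [galoisRep_apply] at h
      have hX : j (MvPolynomial.X i) =
          algebraMap (CoordRing K V) (FunField K V) (SymmetricAlgebra.ι K _ (B i)) := by
        rw [hj_apply, SymmetricAlgebra.equivMvPolynomial_symm_X]
      change funFieldAut ρ g (j (MvPolynomial.X i)) = j (scaleVars _ (MvPolynomial.X i))
      rw [scaleVars_X, map_mul, MvPolynomial.algHom_C, hX,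
        ← Algebra.smul_def]
      exact h
    exact DFunLike.congr_fun hcomp f

theorem leftRegular_injective (K : Type u) (G : Type v) [Field K] [Group G] :
    Function.Injective (Representation.leftRegular K G) := by
  intro g h hgh
  have := congrArg (fun T : Module.End K _ => T (MonoidAlgebra.single 1 1)) hgh
  simp only [Representation.ofMulAction_single, smul_eq_mul, mul_one] at this
  exact MonoidAlgebra.single_left_injective one_ne_zero this

end Main
end EssDim

theorem theorem1p1 :
    (∀ (p : ℕ) (r : ℕ) (K : Type u) [Field K], p.Prime → ringChar K ≠ p →
      (∃ ζ : K, IsPrimitiveRoot ζ p) →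
        EssDim.essDim K (Multiplicative (Fin r → ZMod p)) = (r : Cardinal.{u}) ∧
        ∀ (V : Type v) [AddCommGroup V] [Module K V] [FiniteDimensional K V]
          (ρ : Representation K (Multiplicative (Fin r → ZMod p)) V),
          Function.Injective ρ → EssDim.repEssDim ρ = (r : Cardinal.{max u v})) ∧
    (∀ (r : ℕ) (K : Type u) [Field K], ringChar K ≠ 2 →
        EssDim.essDim K (Multiplicative (Fin r → ZMod 2)) = (r : Cardinal.{u}) ∧
        ∀ (V : Type v) [AddCommGroup V] [Module K V] [FiniteDimensional K V]
          (ρ : Representation K (Multiplicative (Fin r → ZMod 2)) V),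
          Function.Injective ρ → EssDim.repEssDim ρ = (r : Cardinal.{max u v})) := by
  have main : ∀ (p : ℕ) (r : ℕ) (K : Type u) [Field K], p.Prime → ringChar K ≠ p →
      (∃ ζ : K, IsPrimitiveRoot ζ p) →
        EssDim.essDim K (Multiplicative (Fin r → ZMod p)) = (r : Cardinal.{u}) ∧
        ∀ (V : Type v) [AddCommGroup V] [Module K V] [FiniteDimensional K V]
          (ρ : Representation K (Multiplicative (Fin r → ZMod p)) V),
          Function.Injective ρ → EssDim.repEssDim ρ = (r : Cardinal.{max u v}) := by
    intro p r K _ hp hchar hζ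
    have : Fact p.Prime := ⟨hp⟩
    -- If p vanished in K, the characteristic would divide p, hence be 1 or p.
    have hp0 : (p : K) ≠ 0 := fun h =>
      hchar (((Nat.dvd_prime hp).mp (ringChar.dvd h)).resolve_left CharP.ringChar_ne_one)
    have : FiniteDimensional K (MonoidAlgebra K (Multiplicative (Fin r → ZMod p))) := inferInstance
    exact ⟨EssDim.repEssDim_eq hp0 hζ (EssDim.leftRegular_injective _ _),
      fun V _ _ _ ρ hρ => EssDim.repEssDim_eq hp0 hζ hρ⟩
  refine ⟨main, fun r K _ hchar => main 2 r K Nat.prime_two hchar ⟨-1, ?_⟩⟩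
  exact IsPrimitiveRoot.neg_one (ringChar K) hchar
end
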